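/- For $a,b>-1$ and $n\in\mathbb{N}=\{0,1,2,\dots\}$ let $P_n^{(a,b)}$ be the Jacobi polynomial, given for $z\in(-1,1)$ by \[ (1-z)^{a}(1+z)^{b}P_n^{(a,b)}(z)=\frac{(-1)^n}{2^n\,n!}\frac{d^n}{dz^n}\left((1-z)^{a+n}(1+z)^{b+n}\right), \] and let \[ p_n^{(a,b)}(x)=w_n^{(a,b)}\Big(\sin\frac{x}{2}\Big)^{a+1/2}\Big(\cos\frac{x}{2}\Big)^{b+1/2}P_n^{(a,b)}(\cos x),\qquad 0<x<\pi, \] where \[ w_0^{(a,b)}=\sqrt{\frac{\Gamma(a+b+2)}{\Gamma(a+1)\Gamma(b+1)}},\qquad w_n^{(a,b)}=\sqrt{\frac{(2n+a+b+1)\,\Gamma(n+1)\,\Gamma(n+a+b+1)}{\Gamma(n+a+1)\,\Gamma(n+b+1)}}\quad(n\ge 1). \] Let $\alpha,\beta,\gamma,\delta\ge -1/2$ with $\alpha\ne\gamma$ and $\beta\ne\delta$. For $n,m\in\mathbb{N}$ put \[ K_{\alpha,\beta}^{\gamma,\delta}(n,m)=\int_0^{\pi}p_n^{(\gamma,\delta)}(x)\,p_m^{(\alpha,\beta)}(x)\,dx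 , \] the integral being absolutely convergent. Then there is a constant $C>0$, depending only on $\alpha,\beta,\gamma,\delta$, such that \[ |K_{\alpha,\beta}^{\gamma,\delta}(n,m)|\le\frac{C}{|n-m|}\qquad\text{for all } n,m\in\mathbb{N},\ n\ne m . \] -/

import Mathlib

/-- The Jacobi polynomial `P_n^{(a,b)}` on `(-1,1)`, given by Rodrigues' formula. -/
noncomputable def jacobiP (a b : ℝ) (n : ℕ) (z : ℝ) : ℝ :=
  (-1) ^ n / (2 ^ n * (n.factorial : ℝ)) *
    iteratedDeriv n (fun t : ℝ => (1 - t) ^ (a + n) * (1 + t) ^ (b + n)) z /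
      ((1 - z) ^ a * (1 + z) ^ b)

/-- The normalization factor `w_n^{(a,b)}`; the case `n = 0` is separate because
`Γ(a+b+1)` is singular when `a + b + 1 = 0`. -/
noncomputable def jacobiW (a b : ℝ) (n : ℕ) : ℝ :=
  if n = 0 then
    Real.sqrt (Real.Gamma (a + b + 2) / (Real.Gamma (a + 1) * Real.Gamma (b + 1)))
  else
    Real.sqrt ((2 * n + a + b + 1) * Real.Gamma (n + 1) * Real.Gamma (n + a + b + 1) /
      (Real.Gamma (n + a + 1) * Real.Gamma (n + b + 1)))

/-- The functions `p_n^{(a,b)}` on `(0,π)`. -/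
noncomputable def jacobiFun (a b : ℝ) (n : ℕ) (x : ℝ) : ℝ :=
  jacobiW a b n * Real.sin (x / 2) ^ (a + 1 / 2) * Real.cos (x / 2) ^ (b + 1 / 2) *
    jacobiP a b n (Real.cos x)

/-- The transplantation kernel `K_{α,β}^{γ,δ}(n,m)`. -/
noncomputable def transplantationKernel (α β γ δ : ℝ) (n m : ℕ) : ℝ :=
  ∫ x in (0 : ℝ)..Real.pi, jacobiFun γ δ n x * jacobiFun α β m x

open Polynomial in
/-- The Jacobi polynomials as elements of `ℝ[X]`, built from the recursion
`P_{n+1}^{(a,b)} = -((1-X²) Q' + (b-a-(a+b+2)X) Q) / (2(n+1))` with `Q = P_n^{(a+1,b+1)}`. -/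
noncomputable def jacobiPoly : ℕ → ℝ → ℝ → ℝ[X]
  | 0, _, _ => 1
  | n + 1, a, b => C (-1 / (2 * ((n : ℝ) + 1))) *
      ((1 - X ^ 2) * derivative (jacobiPoly n (a + 1) (b + 1)) +
        (C (b - a) - C (a + b + 2) * X) * jacobiPoly n (a + 1) (b + 1))

open Polynomial in
/-- The Jacobi differential equation `(1-z²)P'' + (b-a-(a+b+2)z)P' + lam P = 0`. -/
def SolvesJacobiODE (a b lam : ℝ) (P : ℝ[X]) : Prop :=
  ∀ z : ℝ, (1 - z ^ 2) * (derivative (derivative P)).eval z +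
    (b - a - (a + b + 2) * z) * (derivative P).eval z + lam * P.eval z = 0

section Algebra

open Polynomial

lemma eval_jacobiPoly_succ (n : ℕ) (a b z : ℝ) :
    2 * ((n : ℝ) + 1) * (jacobiPoly (n + 1) a b).eval z =
      -((1 - z ^ 2) * (derivative (jacobiPoly n (a + 1) (b + 1))).eval z +
        (b - a - (a + b + 2) * z) * (jacobiPoly n (a + 1) (b + 1)).eval z) := by
  have : (n : ℝ) + 1 ≠ 0 := by positivity
  simp only [jacobiPoly, eval_mul, eval_add, eval_sub, eval_C, eval_X, eval_one, eval_pow]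
  field_simp

lemma derivative_jacobiPoly_succ_of_ode {n : ℕ} {a b : ℝ}
    (h : SolvesJacobiODE (a + 1) (b + 1) (n * (n + (a + 1) + (b + 1) + 1))
      (jacobiPoly n (a + 1) (b + 1))) (z : ℝ) :
    (derivative (jacobiPoly (n + 1) a b)).eval z =
      (n + a + b + 2) / 2 * (jacobiPoly n (a + 1) (b + 1)).eval z := by
  have hn : (n : ℝ) + 1 ≠ 0 := by positivity
  have h1 := h z
  simp only [jacobiPoly, derivative_mul, derivative_C, derivative_add, derivative_sub,
    derivative_one, derivative_X_pow, derivative_X, eval_mul, eval_add, eval_sub, eval_C, eval_X,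
    eval_one, eval_pow, eval_zero]
  field_simp
  norm_num
  linear_combination (-1 : ℝ) * h1

lemma jacobiPoly_solves (n : ℕ) : ∀ a b : ℝ,
    SolvesJacobiODE a b (n * (n + a + b + 1)) (jacobiPoly n a b) := by
  induction n with
  | zero => intro a b z; simp [jacobiPoly]
  | succ n ih =>
    intro a b z
    have hd := derivative_jacobiPoly_succ_of_ode (ih (a + 1) (b + 1))
    have hd' : derivative (jacobiPoly (n + 1) a b) =
        C ((n + a + b + 2) / 2) * jacobiPoly n (a + 1) (b + 1) := by
      apply Polynomial.funext
      intro r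
      rw [hd r]
      simp
    have h2 := eval_jacobiPoly_succ n a b z
    rw [hd']
    simp only [derivative_mul, derivative_C, eval_mul, eval_C, zero_mul, zero_add]
    push_cast
    linear_combination ((n + a + b + 2) / 2) * h2

lemma derivative_jacobiPoly_succ (n : ℕ) (a b z : ℝ) :
    (derivative (jacobiPoly (n + 1) a b)).eval z =
      (n + a + b + 2) / 2 * (jacobiPoly n (a + 1) (b + 1)).eval z :=
  derivative_jacobiPoly_succ_of_ode (jacobiPoly_solves n _ _) z

lemma SolvesJacobiODE.const_mul {a b lam : ℝ} {P : ℝ[X]} (h : SolvesJacobiODE a b lam P) (w : ℝ) :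
    SolvesJacobiODE a b lam (C w * P) := by
  intro z
  simp only [derivative_mul, derivative_C, eval_mul, eval_C, zero_mul, zero_add]
  linear_combination w * h z

lemma SolvesJacobiODE.comp_neg_X {a b lam : ℝ} {P : ℝ[X]} (h : SolvesJacobiODE a b lam P) :
    SolvesJacobiODE b a lam (P.comp (-X)) := by
  intro z
  simp only [derivative_comp, derivative_neg, derivative_X, derivative_mul, eval_mul, eval_comp,
    eval_neg, eval_X, eval_one, eval_add, derivative_one, eval_zero, neg_zero, zero_mul]
  linear_combination h (-z)

lemma iteratedDeriv_jacobi_weight (n : ℕ) : ∀ (a b z : ℝ), z ∈ Set.Ioo (-1 : ℝ) 1 →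
    iteratedDeriv n (fun t : ℝ => (1 - t) ^ (a + n) * (1 + t) ^ (b + n)) z =
      (1 - z) ^ a * (1 + z) ^ b *
        ((-1) ^ n * (2 ^ n * (n.factorial : ℝ)) * (jacobiPoly n a b).eval z) := by
  induction n with
  | zero => intro a b z _; simp [jacobiPoly]
  | succ n ih =>
    intro a b z hz
    have hf : (fun t : ℝ => (1 - t) ^ (a + (n + 1 : ℕ)) * (1 + t) ^ (b + (n + 1 : ℕ))) =
        fun t : ℝ => (1 - t) ^ (a + 1 + n) * (1 + t) ^ (b + 1 + n) := by
      funext t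
      push_cast
      rw [show a + ((n : ℝ) + 1) = a + 1 + n by ring, show b + ((n : ℝ) + 1) = b + 1 + n by ring]
    rw [hf, iteratedDeriv_succ]
    have hev := Filter.eventuallyEq_of_mem (Ioo_mem_nhds hz.1 hz.2)
      (fun t ht => ih (a + 1) (b + 1) t ht)
    rw [hev.deriv_eq]
    have h1 : 0 < 1 - z := by linarith [hz.2]
    have h2 : 0 < 1 + z := by linarith [hz.1]
    have d1 : HasDerivAt (fun t : ℝ => (1 - t) ^ (a + 1)) (-(a + 1) * (1 - z) ^ a) z := by
      have := ((hasDerivAt_id' z).const_sub 1).rpow_const (p := a + 1) (Or.inl h1.ne')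
      convert this using 1
      rw [add_sub_cancel_right]
      ring
    have d2 : HasDerivAt (fun t : ℝ => (1 + t) ^ (b + 1)) ((b + 1) * (1 + z) ^ b) z := by
      have := ((hasDerivAt_id' z).const_add 1).rpow_const (p := b + 1) (Or.inl h2.ne')
      convert this using 1
      rw [add_sub_cancel_right]
      ring
    have d3 := (d1.mul d2).mul (((jacobiPoly n (a + 1) (b + 1)).hasDerivAt z).const_mul
      ((-1) ^ n * (2 ^ n * (n.factorial : ℝ))))
    refine d3.deriv.trans ?_
    have hs := eval_jacobiPoly_succ n a b z
    rw [Pi.mul_apply, Real.rpow_add_one h1.ne', Real.rpow_add_one h2.ne', Nat.factorial_succ]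
    push_cast
    linear_combination (-(1 - z) ^ a * (1 + z) ^ b *
      ((-1) ^ (n + 1) * (2 ^ n * (n.factorial : ℝ)))) * hs

lemma jacobiP_eq_eval (a b : ℝ) (n : ℕ) {z : ℝ} (hz : z ∈ Set.Ioo (-1 : ℝ) 1) :
    jacobiP a b n z = (jacobiPoly n a b).eval z := by
  have h1 : 0 < (1 - z) ^ a := Real.rpow_pos_of_pos (by linarith [hz.2]) _
  have h2 : 0 < (1 + z) ^ b := Real.rpow_pos_of_pos (by linarith [hz.1]) _
  have h3 : (n.factorial : ℝ) ≠ 0 := by positivity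
  have h4 : ((-1 : ℝ) ^ n) * (-1) ^ n = 1 := by rw [← mul_pow]; simp
  rw [jacobiP, iteratedDeriv_jacobi_weight n a b z hz, div_eq_iff (by positivity)]
  field_simp
  linear_combination ((jacobiPoly n a b).eval z) * h4

end Algebra

/-- The trigonometric weight `sin(x/2)^(a+1/2) cos(x/2)^(b+1/2)`. -/
noncomputable def jacobiEnvelope (a b x : ℝ) : ℝ :=
  Real.sin (x / 2) ^ (a + 1 / 2) * Real.cos (x / 2) ^ (b + 1 / 2)

open Polynomial in
/-- A polynomial in `cos x` times the trigonometric weight. -/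
noncomputable def jacobiMode (a b : ℝ) (P : ℝ[X]) (x : ℝ) : ℝ :=
  jacobiEnvelope a b x * P.eval (Real.cos x)

/-- The logarithmic derivative of `jacobiEnvelope`. -/
noncomputable def jacobiLogDeriv (a b x : ℝ) : ℝ :=
  (a + 1 / 2) / 2 * (Real.cos (x / 2) / Real.sin (x / 2)) -
    (b + 1 / 2) / 2 * (Real.sin (x / 2) / Real.cos (x / 2))

open Polynomial in
/-- The derivative of `jacobiMode` on `(0,π)`. -/
noncomputable def jacobiModeDeriv (a b : ℝ) (P : ℝ[X]) (x : ℝ) : ℝ :=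
  jacobiEnvelope a b x * (jacobiLogDeriv a b x * P.eval (Real.cos x) -
    Real.sin x * (derivative P).eval (Real.cos x))

/-- The potential in the Liouville normal form of the Jacobi equation. -/
noncomputable def jacobiPotential (a b x : ℝ) : ℝ :=
  (1 / 4 - a ^ 2) / (4 * Real.sin (x / 2) ^ 2) + (1 / 4 - b ^ 2) / (4 * Real.cos (x / 2) ^ 2)

section Trig

open Polynomial Real

lemma sin_half_pos {x : ℝ} (hx : x ∈ Set.Ioo 0 π) : 0 < sin (x / 2) :=
  sin_pos_of_pos_of_lt_pi (by linarith [hx.1]) (by linarith [hx.2, hx.1])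

lemma cos_half_pos {x : ℝ} (hx : x ∈ Set.Ioo 0 π) : 0 < cos (x / 2) :=
  cos_pos_of_mem_Ioo ⟨by linarith [hx.1, pi_pos], by linarith [hx.2]⟩

lemma sin_eq_two_mul_half (x : ℝ) : sin x = 2 * sin (x / 2) * cos (x / 2) := by
  rw [← sin_two_mul, mul_div_cancel₀ _ (two_ne_zero)]

lemma cos_eq_sq_sub_sq_half (x : ℝ) : cos x = cos (x / 2) ^ 2 - sin (x / 2) ^ 2 := by
  rw [← cos_two_mul', mul_div_cancel₀ _ (two_ne_zero)]

lemma continuous_jacobiEnvelope {a b : ℝ} (ha : -1 / 2 ≤ a) (hb : -1 / 2 ≤ b) :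
    Continuous (jacobiEnvelope a b) := by
  unfold jacobiEnvelope
  refine Continuous.mul ?_ ?_
  · exact Continuous.rpow_const (by fun_prop) fun x => Or.inr (by linarith)
  · exact Continuous.rpow_const (by fun_prop) fun x => Or.inr (by linarith)

lemma continuous_jacobiMode {a b : ℝ} (ha : -1 / 2 ≤ a) (hb : -1 / 2 ≤ b) (P : ℝ[X]) :
    Continuous (jacobiMode a b P) :=
  (continuous_jacobiEnvelope ha hb).mul (P.continuous.comp continuous_cos)

lemma jacobiEnvelope_pos (a b : ℝ) {x : ℝ} (hx : x ∈ Set.Ioo 0 π) : 0 < jacobiEnvelope a b x :=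
  mul_pos (rpow_pos_of_pos (sin_half_pos hx) _) (rpow_pos_of_pos (cos_half_pos hx) _)

lemma jacobiEnvelope_reflect (a b x : ℝ) :
    jacobiEnvelope a b (π - x) = jacobiEnvelope b a x := by
  unfold jacobiEnvelope
  rw [show (π - x) / 2 = π / 2 - x / 2 by ring, sin_pi_div_two_sub, cos_pi_div_two_sub, mul_comm]

lemma jacobiMode_reflect (a b : ℝ) (P : ℝ[X]) (x : ℝ) :
    jacobiMode b a (P.comp (-X)) (π - x) = jacobiMode a b P x := by
  unfold jacobiMode
  rw [jacobiEnvelope_reflect, cos_pi_sub]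
  simp [eval_comp]

lemma hasDerivAt_sin_half (x : ℝ) :
    HasDerivAt (fun t => sin (t / 2)) (cos (x / 2) / 2) x := by
  have := (hasDerivAt_sin (x / 2)).comp x ((hasDerivAt_id' x).div_const 2)
  refine this.congr_deriv ?_
  ring

lemma hasDerivAt_cos_half (x : ℝ) :
    HasDerivAt (fun t => cos (t / 2)) (-sin (x / 2) / 2) x := by
  have := (hasDerivAt_cos (x / 2)).comp x ((hasDerivAt_id' x).div_const 2)
  refine this.congr_deriv ?_
  ring

lemma hasDerivAt_eval_cos (P : ℝ[X]) (x : ℝ) :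
    HasDerivAt (fun t => P.eval (cos t)) (-(sin x * (derivative P).eval (cos x))) x := by
  have := (P.hasDerivAt (cos x)).comp x (hasDerivAt_cos x)
  refine this.congr_deriv ?_
  ring

lemma hasDerivAt_jacobiEnvelope (a b : ℝ) {x : ℝ} (hx : x ∈ Set.Ioo 0 π) :
    HasDerivAt (jacobiEnvelope a b) (jacobiEnvelope a b x * jacobiLogDeriv a b x) x := by
  have hs := sin_half_pos hx
  have hc := cos_half_pos hx
  have := ((hasDerivAt_sin_half x).rpow_const (p := a + 1 / 2) (Or.inl hs.ne')).mul
    ((hasDerivAt_cos_half x).rpow_const (p := b + 1 / 2) (Or.inl hc.ne'))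
  refine this.congr_deriv ?_
  rw [rpow_sub_one hs.ne', rpow_sub_one hc.ne']
  unfold jacobiEnvelope jacobiLogDeriv
  field_simp
  ring

lemma hasDerivAt_jacobiMode (a b : ℝ) (P : ℝ[X]) {x : ℝ} (hx : x ∈ Set.Ioo 0 π) :
    HasDerivAt (jacobiMode a b P) (jacobiModeDeriv a b P x) x := by
  have := (hasDerivAt_jacobiEnvelope a b hx).mul (hasDerivAt_eval_cos P x)
  refine this.congr_deriv ?_
  unfold jacobiModeDeriv
  ring

lemma hasDerivAt_jacobiLogDeriv (a b : ℝ) {x : ℝ} (hx : x ∈ Set.Ioo 0 π) :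
    HasDerivAt (jacobiLogDeriv a b)
      (-(a + 1 / 2) / (4 * sin (x / 2) ^ 2) - (b + 1 / 2) / (4 * cos (x / 2) ^ 2)) x := by
  have hs := sin_half_pos hx
  have hc := cos_half_pos hx
  have h := sin_sq_add_cos_sq (x / 2)
  have := (((hasDerivAt_cos_half x).div (hasDerivAt_sin_half x) hs.ne').const_mul
    ((a + 1 / 2) / 2)).sub (((hasDerivAt_sin_half x).div (hasDerivAt_cos_half x) hc.ne').const_mul
    ((b + 1 / 2) / 2))
  refine this.congr_deriv ?_
  have e1 : -sin (x / 2) / 2 * sin (x / 2) - cos (x / 2) * (cos (x / 2) / 2) = -1 / 2 := by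
    linear_combination (-1 / 2 : ℝ) * h
  have e2 : cos (x / 2) / 2 * cos (x / 2) - sin (x / 2) * (-sin (x / 2) / 2) = 1 / 2 := by
    linear_combination (1 / 2 : ℝ) * h
  rw [e1, e2]
  field_simp
  ring

lemma jacobiLogDeriv_mul_sin (a b : ℝ) {x : ℝ} (hx : x ∈ Set.Ioo 0 π) :
    2 * jacobiLogDeriv a b x * sin x = a - b + (a + b + 1) * cos x := by
  have hs := (sin_half_pos hx).ne'
  have hc := (cos_half_pos hx).ne'
  have h := sin_sq_add_cos_sq (x / 2)
  rw [sin_eq_two_mul_half x, cos_eq_sq_sub_sq_half x]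
  unfold jacobiLogDeriv
  field_simp
  linear_combination (a - b) * h

lemma jacobiLogDeriv_sq (a b : ℝ) {x : ℝ} (hx : x ∈ Set.Ioo 0 π) :
    jacobiLogDeriv a b x ^ 2 +
      (-(a + 1 / 2) / (4 * sin (x / 2) ^ 2) - (b + 1 / 2) / (4 * cos (x / 2) ^ 2)) =
      -jacobiPotential a b x - ((a + b + 1) / 2) ^ 2 := by
  have hs := (sin_half_pos hx).ne'
  have hc := (cos_half_pos hx).ne'
  have h := sin_sq_add_cos_sq (x / 2)
  have hc2 : cos (x / 2) ^ 2 = 1 - sin (x / 2) ^ 2 := by linarith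
  have hA : (cos (x / 2) / sin (x / 2)) ^ 2 = 1 / sin (x / 2) ^ 2 - 1 := by
    field_simp
    linarith
  have hB : (sin (x / 2) / cos (x / 2)) ^ 2 = 1 / cos (x / 2) ^ 2 - 1 := by
    field_simp
    linarith
  have hAB : (cos (x / 2) / sin (x / 2)) * (sin (x / 2) / cos (x / 2)) = 1 := by
    field_simp
  have e1 : ∀ r s : ℝ, r / (4 * s) = r / 4 * (1 / s) := by
    intro r s
    ring
  unfold jacobiLogDeriv jacobiPotential
  rw [e1, e1, e1, e1]
  linear_combination ((a + 1 / 2) / 2) ^ 2 * hA + ((b + 1 / 2) / 2) ^ 2 * hB -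
    2 * ((a + 1 / 2) / 2) * ((b + 1 / 2) / 2) * hAB

lemma jacobi_ode_cos {a b lam : ℝ} {P : ℝ[X]} (h : SolvesJacobiODE a b lam P) (x : ℝ) :
    sin x ^ 2 * (derivative (derivative P)).eval (cos x) =
      -((b - a - (a + b + 2) * cos x) * (derivative P).eval (cos x) + lam * P.eval (cos x)) := by
  rw [sin_sq]
  linear_combination h (cos x)

lemma hasDerivAt_jacobiModeDeriv {a b lam : ℝ} {P : ℝ[X]} (h : SolvesJacobiODE a b lam P)
    {x : ℝ} (hx : x ∈ Set.Ioo 0 π) :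
    HasDerivAt (jacobiModeDeriv a b P)
      (-(lam + ((a + b + 1) / 2) ^ 2 + jacobiPotential a b x) * jacobiMode a b P x) x := by
  have := (hasDerivAt_jacobiEnvelope a b hx).mul
    (((hasDerivAt_jacobiLogDeriv a b hx).mul (hasDerivAt_eval_cos P x)).sub
      ((hasDerivAt_sin x).mul (hasDerivAt_eval_cos (derivative P) x)))
  refine this.congr_deriv ?_
  have h1 := jacobiLogDeriv_mul_sin a b hx
  have h2 := jacobiLogDeriv_sq a b hx
  have h3 := jacobi_ode_cos h x
  simp only [Pi.mul_apply, Pi.sub_apply]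
  unfold jacobiMode
  linear_combination (jacobiEnvelope a b x * P.eval (cos x)) * h2 +
    jacobiEnvelope a b x * h3 - jacobiEnvelope a b x * (derivative P).eval (cos x) * h1

lemma hasDerivAt_envelope_sq_mul {a b lam : ℝ} {P : ℝ[X]} (h : SolvesJacobiODE a b lam P)
    {x : ℝ} (hx : x ∈ Set.Ioo 0 π) :
    HasDerivAt (fun t => jacobiEnvelope a b t ^ 2 * (sin t * (derivative P).eval (cos t)))
      (lam * jacobiEnvelope a b x ^ 2 * P.eval (cos x)) x := by
  have := ((hasDerivAt_jacobiEnvelope a b hx).pow 2).mul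
      ((hasDerivAt_sin x).mul (hasDerivAt_eval_cos (derivative P) x))
  refine this.congr_deriv ?_
  have h1 := jacobiLogDeriv_mul_sin a b hx
  have h3 := jacobi_ode_cos h x
  simp only [Pi.mul_apply, Pi.pow_apply]
  push_cast
  linear_combination -jacobiEnvelope a b x ^ 2 * h3 +
    jacobiEnvelope a b x ^ 2 * (derivative P).eval (cos x) * h1

end Trig

section Norm

open Polynomial Real MeasureTheory

lemma jacobiEnvelope_add_one (a b : ℝ) {x : ℝ} (hx : x ∈ Set.Ioo 0 π) :
    jacobiEnvelope a b x * sin x = 2 * jacobiEnvelope (a + 1) (b + 1) x := by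
  have hs := sin_half_pos hx
  have hc := cos_half_pos hx
  unfold jacobiEnvelope
  rw [show a + 1 + 1 / 2 = a + 1 / 2 + 1 by ring, show b + 1 + 1 / 2 = b + 1 / 2 + 1 by ring,
    rpow_add_one hs.ne', rpow_add_one hc.ne', sin_eq_two_mul_half x]
  ring

lemma integral_jacobiMode_sq_derivative {a b lam : ℝ} (ha : -1 / 2 ≤ a) (hb : -1 / 2 ≤ b)
    {P : ℝ[X]} (h : SolvesJacobiODE a b lam P) :
    lam * ∫ x in (0 : ℝ)..π, jacobiMode a b P x ^ 2 =
      4 * ∫ x in (0 : ℝ)..π, jacobiMode (a + 1) (b + 1) (derivative P) x ^ 2 := by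
  have c1 := continuous_jacobiMode ha hb P
  have c2 := continuous_jacobiMode (a := a + 1) (b := b + 1) (by linarith) (by linarith)
    (derivative P)
  have c3 := continuous_jacobiEnvelope ha hb
  have key := intervalIntegral.integral_eq_sub_of_hasDerivAt_of_le (a := 0) (b := π)
    (f := fun t => jacobiEnvelope a b t ^ 2 * (sin t * (derivative P).eval (cos t)) *
      P.eval (cos t))
    (f' := fun t => lam * jacobiMode a b P t ^ 2 -
      4 * jacobiMode (a + 1) (b + 1) (derivative P) t ^ 2) pi_pos.le
    (by fun_prop) (fun x hx => by
      refine ((hasDerivAt_envelope_sq_mul h hx).mul (hasDerivAt_eval_cos P x)).congr_deriv ?_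
      have he := jacobiEnvelope_add_one a b hx
      unfold jacobiMode
      linear_combination (-(jacobiEnvelope a b x * sin x +
        2 * jacobiEnvelope (a + 1) (b + 1) x) * (derivative P).eval (cos x) ^ 2) * he)
    (Continuous.intervalIntegrable (by fun_prop) _ _)
  rw [intervalIntegral.integral_sub (Continuous.intervalIntegrable (by fun_prop) _ _)
    (Continuous.intervalIntegrable (by fun_prop) _ _), intervalIntegral.integral_const_mul,
    intervalIntegral.integral_const_mul] at key
  simp only [sin_zero, sin_pi, zero_mul, mul_zero, sub_zero] at key
  linarith

lemma integral_jacobiMode_jacobiPoly_succ {a b : ℝ} (ha : -1 / 2 ≤ a) (hb : -1 / 2 ≤ b) (n : ℕ) :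
    ((n : ℝ) + 1) * ∫ x in (0 : ℝ)..π, jacobiMode a b (jacobiPoly (n + 1) a b) x ^ 2 =
      (n + a + b + 2) * ∫ x in (0 : ℝ)..π,
        jacobiMode (a + 1) (b + 1) (jacobiPoly n (a + 1) (b + 1)) x ^ 2 := by
  have h := integral_jacobiMode_sq_derivative ha hb (jacobiPoly_solves (n + 1) a b)
  have e : ∀ x, jacobiMode (a + 1) (b + 1) (derivative (jacobiPoly (n + 1) a b)) x ^ 2 =
      ((n + a + b + 2) / 2) ^ 2 *
        jacobiMode (a + 1) (b + 1) (jacobiPoly n (a + 1) (b + 1)) x ^ 2 := by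
    intro x
    unfold jacobiMode
    rw [derivative_jacobiPoly_succ]
    ring
  simp_rw [e] at h
  rw [intervalIntegral.integral_const_mul] at h
  have hpos : (n : ℝ) + a + b + 2 ≠ 0 := by
    have : (0 : ℝ) ≤ n := n.cast_nonneg
    intro h0
    linarith
  apply mul_left_cancel₀ hpos
  push_cast at h
  linear_combination h

lemma integral_rpow_mul_one_sub_rpow {a b : ℝ} (ha : 0 ≤ a) (hb : 0 ≤ b) :
    ∫ u in (0 : ℝ)..1, u ^ a * (1 - u) ^ b =
      Gamma (a + 1) * Gamma (b + 1) / Gamma (a + b + 2) := by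
  have h := Complex.betaIntegral_eq_Gamma_mul_div ((a + 1 : ℝ) : ℂ) ((b + 1 : ℝ) : ℂ)
    (by rw [Complex.ofReal_re]; linarith) (by rw [Complex.ofReal_re]; linarith)
  rw [← Complex.ofReal_add, Complex.Gamma_ofReal, Complex.Gamma_ofReal, Complex.Gamma_ofReal,
    Complex.betaIntegral] at h
  have h2 : ∫ x in (0 : ℝ)..1, (x : ℂ) ^ (((a + 1 : ℝ) : ℂ) - 1) *
      (1 - (x : ℂ)) ^ (((b + 1 : ℝ) : ℂ) - 1) =
      ∫ x in (0 : ℝ)..1, ((x ^ a * (1 - x) ^ b : ℝ) : ℂ) := by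
    refine intervalIntegral.integral_congr_Ioo_of_le zero_le_one fun x hx => ?_
    rw [Complex.ofReal_mul, Complex.ofReal_cpow hx.1.le, Complex.ofReal_cpow (by linarith [hx.2])]
    push_cast
    simp
  rw [h2, intervalIntegral.integral_ofReal] at h
  rw [show a + b + 2 = a + 1 + (b + 1) by ring]
  exact_mod_cast h

lemma integral_jacobiEnvelope_sq {a b : ℝ} (ha : 0 ≤ a) (hb : 0 ≤ b) :
    ∫ x in (0 : ℝ)..π, jacobiEnvelope a b x ^ 2 =
      Gamma (a + 1) * Gamma (b + 1) / Gamma (a + b + 2) := by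
  have h := intervalIntegral.integral_comp_mul_deriv (a := 0) (b := π)
    (f := fun x => sin (x / 2) ^ 2) (f' := fun x => sin (x / 2) * cos (x / 2))
    (g := fun u => u ^ a * (1 - u) ^ b)
    (fun x _ => by
      refine ((hasDerivAt_sin_half x).pow 2).congr_deriv ?_
      push_cast
      ring) (by fun_prop)
    ((continuous_id.rpow_const fun _ => Or.inr ha).mul
      ((continuous_const.sub continuous_id).rpow_const fun _ => Or.inr hb))
  simp only [zero_div, sin_zero, sin_pi_div_two, one_pow, ne_eq, OfNat.ofNat_ne_zero,
    not_false_eq_true, zero_pow] at h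
  rw [← integral_rpow_mul_one_sub_rpow ha hb, ← h]
  refine intervalIntegral.integral_congr_Ioo_of_le pi_pos.le fun x hx => ?_
  have hs := sin_half_pos hx
  have hc := cos_half_pos hx
  simp only [Function.comp_apply]
  rw [← cos_sq', ← rpow_natCast, ← rpow_natCast, ← rpow_natCast, ← rpow_mul hs.le,
    ← rpow_mul hc.le]
  unfold jacobiEnvelope
  rw [mul_rpow (by positivity) (by positivity), ← rpow_mul hs.le, ← rpow_mul hc.le]
  push_cast
  rw [show (a + 1 / 2) * 2 = 2 * a + 1 by ring, show (b + 1 / 2) * 2 = 2 * b + 1 by ring,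
    rpow_add_one hs.ne', rpow_add_one hc.ne']
  ring

lemma jacobiW_zero_sq {a b : ℝ} (ha : -1 / 2 ≤ a) (hb : -1 / 2 ≤ b) :
    jacobiW a b 0 ^ 2 = Gamma (a + b + 2) / (Gamma (a + 1) * Gamma (b + 1)) := by
  have h1 : 0 < Gamma (a + 1) := Gamma_pos_of_pos (by linarith)
  have h2 : 0 < Gamma (b + 1) := Gamma_pos_of_pos (by linarith)
  have h3 : 0 < Gamma (a + b + 2) := Gamma_pos_of_pos (by linarith)
  rw [jacobiW, if_pos rfl, sq_sqrt (by positivity)]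

lemma jacobiW_succ_sq {a b : ℝ} (ha : -1 / 2 ≤ a) (hb : -1 / 2 ≤ b) (n : ℕ) :
    jacobiW a b (n + 1) ^ 2 = (2 * n + a + b + 3) * Gamma (n + 2) * Gamma (n + a + b + 2) /
      (Gamma (n + a + 2) * Gamma (n + b + 2)) := by
  have h0 : (0 : ℝ) ≤ n := n.cast_nonneg
  have h1 : 0 < Gamma (n + a + 2) := Gamma_pos_of_pos (by linarith)
  have h2 : 0 < Gamma (n + b + 2) := Gamma_pos_of_pos (by linarith)
  have h3 : 0 < Gamma (n + a + b + 2) := Gamma_pos_of_pos (by linarith)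
  have h4 : 0 < Gamma ((n : ℝ) + 2) := Gamma_pos_of_pos (by linarith)
  have h5 : 0 < 2 * n + a + b + 3 := by linarith
  rw [jacobiW, if_neg (Nat.succ_ne_zero n)]
  push_cast
  rw [show 2 * ((n : ℝ) + 1) + a + b + 1 = 2 * n + a + b + 3 by ring,
    show (n : ℝ) + 1 + 1 = n + 2 by ring, show (n : ℝ) + 1 + a + b + 1 = n + a + b + 2 by ring,
    show (n : ℝ) + 1 + a + 1 = n + a + 2 by ring, show (n : ℝ) + 1 + b + 1 = n + b + 2 by ring,
    sq_sqrt (by positivity)]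

lemma jacobiW_succ_sq_ladder {a b : ℝ} (ha : -1 / 2 ≤ a) (hb : -1 / 2 ≤ b) (n : ℕ) :
    jacobiW a b (n + 1) ^ 2 * (n + a + b + 2) = jacobiW (a + 1) (b + 1) n ^ 2 * (n + 1) := by
  cases n with
  | zero =>
    rw [jacobiW_succ_sq ha hb, jacobiW_zero_sq (by linarith) (by linarith)]
    rw [show a + 1 + (b + 1) + 2 = a + b + 2 + 1 + 1 by ring, Gamma_add_one (by linarith),
      Gamma_add_one (by linarith)]
    have : Gamma 2 = 1 := Gamma_two
    push_cast
    simp only [zero_add, this, mul_zero]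
    rw [show a + 1 + 1 = a + 2 by ring, show b + 1 + 1 = b + 2 by ring]
    ring
  | succ n =>
    have h0 : (0 : ℝ) ≤ n := n.cast_nonneg
    rw [jacobiW_succ_sq ha hb, jacobiW_succ_sq (by linarith) (by linarith)]
    push_cast
    rw [show (n : ℝ) + (a + 1) + (b + 1) + 2 = (n + 1 + a + b + 2) + 1 by ring,
      Gamma_add_one (s := (n : ℝ) + 1 + a + b + 2) (by linarith),
      show (n : ℝ) + 1 + 2 = n + 2 + 1 by ring, Gamma_add_one (s := (n : ℝ) + 2) (by linarith),
      show (n : ℝ) + 1 + a + 2 = n + (a + 1) + 2 by ring,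
      show (n : ℝ) + 1 + b + 2 = n + (b + 1) + 2 by ring]
    ring

lemma jacobiW_sq_mul_integral_succ {a b : ℝ} (ha : -1 / 2 ≤ a) (hb : -1 / 2 ≤ b) (n : ℕ) :
    jacobiW a b (n + 1) ^ 2 * ∫ x in (0 : ℝ)..π, jacobiMode a b (jacobiPoly (n + 1) a b) x ^ 2 =
      jacobiW (a + 1) (b + 1) n ^ 2 * ∫ x in (0 : ℝ)..π,
        jacobiMode (a + 1) (b + 1) (jacobiPoly n (a + 1) (b + 1)) x ^ 2 := by
  have h0 : (0 : ℝ) < n + 1 := by positivity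
  have h1 := integral_jacobiMode_jacobiPoly_succ ha hb n
  have h2 := jacobiW_succ_sq_ladder ha hb n
  apply mul_left_cancel₀ h0.ne'
  linear_combination jacobiW a b (n + 1) ^ 2 * h1 + (∫ x in (0 : ℝ)..π,
        jacobiMode (a + 1) (b + 1) (jacobiPoly n (a + 1) (b + 1)) x ^ 2) * h2

lemma jacobiW_sq_mul_integral_of_nonneg (n : ℕ) : ∀ {a b : ℝ}, 0 ≤ a → 0 ≤ b →
    jacobiW a b n ^ 2 * ∫ x in (0 : ℝ)..π, jacobiMode a b (jacobiPoly n a b) x ^ 2 = 1 := by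
  induction n with
  | zero =>
    intro a b ha hb
    have h1 : 0 < Gamma (a + 1) := Gamma_pos_of_pos (by linarith)
    have h2 : 0 < Gamma (b + 1) := Gamma_pos_of_pos (by linarith)
    have h3 : 0 < Gamma (a + b + 2) := Gamma_pos_of_pos (by linarith)
    have h := integral_jacobiEnvelope_sq ha hb
    simp only [jacobiMode, jacobiPoly, eval_one, mul_one]
    rw [h, jacobiW_zero_sq (by linarith) (by linarith)]
    field_simp
  | succ n ih =>
    intro a b ha hb
    rw [jacobiW_sq_mul_integral_succ (by linarith) (by linarith)]
    exact ih (by linarith) (by linarith)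

/-- The normalized Jacobi polynomial `w_n^{(a,b)} P_n^{(a,b)}`. -/
noncomputable def normalizedJacobiPoly (n : ℕ) (a b : ℝ) : ℝ[X] :=
  C (jacobiW a b n) * jacobiPoly n a b

lemma integral_normalizedJacobiPoly_sq {a b : ℝ} (ha : -1 / 2 ≤ a) (hb : -1 / 2 ≤ b) {n : ℕ}
    (hn : n ≠ 0) :
    ∫ x in (0 : ℝ)..π, jacobiMode a b (normalizedJacobiPoly n a b) x ^ 2 = 1 := by
  obtain ⟨k, rfl⟩ := Nat.exists_eq_succ_of_ne_zero hn
  have e : ∀ x, jacobiMode a b (normalizedJacobiPoly (k + 1) a b) x ^ 2 =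
      jacobiW a b (k + 1) ^ 2 * jacobiMode a b (jacobiPoly (k + 1) a b) x ^ 2 := by
    intro x
    simp only [jacobiMode, normalizedJacobiPoly, eval_mul, eval_C]
    ring
  simp_rw [Nat.succ_eq_add_one, e]
  rw [intervalIntegral.integral_const_mul, jacobiW_sq_mul_integral_succ ha hb]
  exact jacobiW_sq_mul_integral_of_nonneg k (by linarith) (by linarith)

lemma jacobiFun_eq_jacobiMode (a b : ℝ) (n : ℕ) {x : ℝ} (hx : x ∈ Set.Ioo 0 π) :
    jacobiFun a b n x = jacobiMode a b (normalizedJacobiPoly n a b) x := by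
  have h1 : cos x < 1 := by
    simpa using cos_lt_cos_of_nonneg_of_le_pi le_rfl hx.2.le hx.1
  have h2 : -1 < cos x := by
    simpa using cos_lt_cos_of_nonneg_of_le_pi hx.1.le le_rfl hx.2
  simp only [jacobiFun, jacobiP_eq_eval a b n ⟨h2, h1⟩, jacobiMode, jacobiEnvelope,
    normalizedJacobiPoly, eval_mul, eval_C]
  ring

end Norm

section Energy

open Real MeasureTheory

variable {u v q : ℝ → ℝ} {N Q l : ℝ}

lemma hasDerivAt_endpoint_primitive {x : ℝ} (hx : x ∈ Set.Ioo 0 π) :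
    HasDerivAt (fun t : ℝ => 1 / (π - t) - 1 / t) (1 / x ^ 2 + 1 / (π - x) ^ 2) x := by
  have h1 : π - x ≠ 0 := by linarith [hx.2]
  have h2 : x ≠ 0 := by linarith [hx.1]
  have := ((hasDerivAt_const x (1 : ℝ)).div ((hasDerivAt_id' x).const_sub π) h1).sub
    ((hasDerivAt_const x (1 : ℝ)).div (hasDerivAt_id' x) h2)
  refine this.congr_deriv ?_
  field_simp
  ring

lemma endpoint_weight_le {x : ℝ} (hl : 0 < l) (hx : x ∈ Set.Icc l (π - l)) :
    1 / x ^ 2 + 1 / (π - x) ^ 2 ≤ 2 / l ^ 2 := by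
  have h1 : 1 / x ^ 2 ≤ 1 / l ^ 2 := by
    have := hx.1
    gcongr
  have h2 : 1 / (π - x) ^ 2 ≤ 1 / l ^ 2 := by
    have : l ≤ π - x := by linarith [hx.2]
    gcongr
  calc _ ≤ 1 / l ^ 2 + 1 / l ^ 2 := add_le_add h1 h2
    _ = 2 / l ^ 2 := by ring

lemma endpoint_primitive_sub_le {x y : ℝ} (hl : 0 < l) (hx : x ∈ Set.Icc l (π - l))
    (hy : y ∈ Set.Icc l (π - l)) :
    (1 / (π - y) - 1 / y) - (1 / (π - x) - 1 / x) ≤ 2 / l := by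
  have a1 : 1 / (π - y) ≤ 1 / l := by
    have : l ≤ π - y := by linarith [hy.2]
    gcongr
  have a2 : 1 / x ≤ 1 / l := by
    have := hx.1
    gcongr
  have a3 : 0 < 1 / y := by
    have := hl.trans_le hy.1
    positivity
  have a4 : 0 < 1 / (π - x) := by
    have : 0 < π - x := by linarith [hx.2]
    positivity
  have : 2 / l = 1 / l + 1 / l := by ring
  linarith

lemma two_mul_abs_mul_le_energy (hN : 0 < N) (r s : ℝ) :
    2 * |r * s| ≤ (s ^ 2 + N ^ 2 * r ^ 2) / N := by
  rw [le_div_iff₀ hN, abs_mul, ← sq_abs r, ← sq_abs s]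
  nlinarith [sq_nonneg (|s| - N * |r|)]

/-- The energy `v² + N²u²` of a solution of `u'' + (N² + q)u = 0` with a potential having at most
inverse square singularities is comparable at any two points away from the end points. -/
lemma energy_le_exp_mul_energy (hN : 0 < N) (hl : 0 < l) (hQ : 0 ≤ Q)
    (hu : ∀ x ∈ Set.Ioo 0 π, HasDerivAt u (v x) x)
    (hv : ∀ x ∈ Set.Ioo 0 π, HasDerivAt v (-(N ^ 2 + q x) * u x) x)
    (hq : ∀ x ∈ Set.Ioo 0 π, |q x| ≤ Q * (1 / x ^ 2 + 1 / (π - x) ^ 2))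
    {x y : ℝ} (hx : x ∈ Set.Icc l (π - l)) (hy : y ∈ Set.Icc l (π - l)) :
    v x ^ 2 + N ^ 2 * u x ^ 2 ≤ exp (2 * Q / (N * l)) * (v y ^ 2 + N ^ 2 * u y ^ 2) := by
  set E : ℝ → ℝ := fun t => v t ^ 2 + N ^ 2 * u t ^ 2 with hE
  set G : ℝ → ℝ := fun t => Q / N * (1 / (π - t) - 1 / t) with hG
  set g : ℝ → ℝ := fun t => Q / N * (1 / t ^ 2 + 1 / (π - t) ^ 2) with hg
  have hE0 : ∀ t, 0 ≤ E t := fun t => by positivity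
  have hE' : ∀ t ∈ Set.Ioo 0 π, HasDerivAt E (-2 * q t * (u t * v t)) t := by
    intro t ht
    refine (((hv t ht).pow 2).add (((hu t ht).pow 2).const_mul (N ^ 2))).congr_deriv ?_
    push_cast
    ring
  have hG' : ∀ t ∈ Set.Ioo 0 π, HasDerivAt G (g t) t := fun t ht =>
    (hasDerivAt_endpoint_primitive ht).const_mul _
  have hbd : ∀ t ∈ Set.Ioo 0 π, |-2 * q t * (u t * v t)| ≤ g t * E t := by
    intro t ht
    calc |-2 * q t * (u t * v t)| = |q t| * (2 * |u t * v t|) := by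
          rw [abs_mul, abs_mul]
          norm_num
          ring
      _ ≤ (Q * (1 / t ^ 2 + 1 / (π - t) ^ 2)) * (E t / N) :=
          mul_le_mul (hq t ht) (two_mul_abs_mul_le_energy hN _ _) (by positivity) (by positivity)
      _ = g t * E t := by rw [hg]; ring
  have hx' : x ∈ Set.Ioo 0 π := ⟨by linarith [hx.1], by linarith [hx.2]⟩
  have hy' : y ∈ Set.Ioo 0 π := ⟨by linarith [hy.1], by linarith [hy.2]⟩
  have mono : MonotoneOn (fun t => E t * exp (G t)) (Set.Ioo 0 π) := by
    have hd : ∀ t ∈ Set.Ioo 0 π, HasDerivAt (fun t => E t * exp (G t))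
        (-2 * q t * (u t * v t) * exp (G t) + E t * (exp (G t) * g t)) t :=
      fun t ht => (hE' t ht).mul (hG' t ht).exp
    refine monotoneOn_of_deriv_nonneg (convex_Ioo _ _)
      (fun t ht => (hd t ht).continuousAt.continuousWithinAt) ?_ ?_
    · rw [interior_Ioo]
      exact fun t ht => (hd t ht).differentiableAt.differentiableWithinAt
    · rw [interior_Ioo]
      intro t ht
      rw [(hd t ht).deriv]
      have h1 := (abs_le.mp (hbd t ht)).1
      have h2 := exp_pos (G t)
      calc (0 : ℝ) ≤ (-2 * q t * (u t * v t) + g t * E t) * exp (G t) :=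
            mul_nonneg (by linarith) h2.le
        _ = _ := by ring
  have anti : AntitoneOn (fun t => E t * exp (-G t)) (Set.Ioo 0 π) := by
    have hd : ∀ t ∈ Set.Ioo 0 π, HasDerivAt (fun t => E t * exp (-G t))
        (-2 * q t * (u t * v t) * exp (-G t) + E t * (exp (-G t) * -g t)) t :=
      fun t ht => (hE' t ht).mul (hG' t ht).neg.exp
    refine antitoneOn_of_deriv_nonpos (convex_Ioo _ _)
      (fun t ht => (hd t ht).continuousAt.continuousWithinAt) ?_ ?_
    · rw [interior_Ioo]
      exact fun t ht => (hd t ht).differentiableAt.differentiableWithinAt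
    · rw [interior_Ioo]
      intro t ht
      rw [(hd t ht).deriv]
      have h1 := (abs_le.mp (hbd t ht)).2
      have h2 := exp_pos (-G t)
      calc _ = (-2 * q t * (u t * v t) - g t * E t) * exp (-G t) := by ring
        _ ≤ 0 := mul_nonpos_of_nonpos_of_nonneg (by linarith) h2.le
  have hGd : ∀ s ∈ Set.Icc l (π - l), ∀ t ∈ Set.Icc l (π - l), G t - G s ≤ 2 * Q / (N * l) := by
    intro s hs t ht
    calc G t - G s = Q / N * ((1 / (π - t) - 1 / t) - (1 / (π - s) - 1 / s)) := by rw [hG]; ring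
      _ ≤ Q / N * (2 / l) := by
          have := endpoint_primitive_sub_le hl hs ht
          gcongr
      _ = 2 * Q / (N * l) := by field_simp
  change E x ≤ exp (2 * Q / (N * l)) * E y
  rcases le_total x y with hxy | hxy
  · have h1 := mono hx' hy' hxy
    calc E x = E x * exp (G x) * exp (-G x) := by rw [mul_assoc, ← exp_add]; simp
      _ ≤ E y * exp (G y) * exp (-G x) := by
          have := exp_pos (-G x)
          exact mul_le_mul_of_nonneg_right h1 this.le
      _ = exp (G y - G x) * E y := by rw [mul_assoc, ← exp_add, mul_comm, sub_eq_add_neg]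
      _ ≤ _ := mul_le_mul_of_nonneg_right (exp_le_exp.mpr (hGd x hx y hy)) (hE0 y)
  · have h1 := anti hy' hx' hxy
    calc E x = E x * exp (-G x) * exp (G x) := by rw [mul_assoc, ← exp_add]; simp
      _ ≤ E y * exp (-G y) * exp (G x) := by
          have := exp_pos (G x)
          exact mul_le_mul_of_nonneg_right h1 this.le
      _ = exp (G x - G y) * E y := by
          rw [mul_assoc, ← exp_add, mul_comm, sub_eq_add_neg, add_comm]
      _ ≤ _ := mul_le_mul_of_nonneg_right (exp_le_exp.mpr (hGd y hy x hx)) (hE0 y)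

lemma energy_le_of_integral_sq_le_one (hN : 0 < N) (hl : 0 < l) (hl1 : l ≤ 1) (hQ : 0 ≤ Q)
    (hu : ∀ x ∈ Set.Ioo 0 π, HasDerivAt u (v x) x)
    (hv : ∀ x ∈ Set.Ioo 0 π, HasDerivAt v (-(N ^ 2 + q x) * u x) x)
    (hq : ∀ x ∈ Set.Ioo 0 π, |q x| ≤ Q * (1 / x ^ 2 + 1 / (π - x) ^ 2))
    (hqc : ContinuousOn q (Set.Ioo 0 π)) (huc : Continuous u)
    (hint : ∫ x in (0 : ℝ)..π, u x ^ 2 ≤ 1) (hK : 2 * exp (2 * Q / (N * l)) ^ 2 ≤ N)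
    {x : ℝ} (hx : x ∈ Set.Icc l (π - l)) :
    v x ^ 2 + N ^ 2 * u x ^ 2 ≤ 2 * exp (2 * Q / (N * l)) * (2 * N ^ 2 + 2 * Q / l ^ 2) := by
  set K := exp (2 * Q / (N * l)) with hKdef
  have hK0 : 0 < K := exp_pos _
  set E : ℝ → ℝ := fun t => v t ^ 2 + N ^ 2 * u t ^ 2 with hE
  have hE0 : ∀ t, 0 ≤ E t := fun t => by positivity
  have hcmp : ∀ s ∈ Set.Icc l (π - l), ∀ t ∈ Set.Icc l (π - l), E s ≤ K * E t :=
    fun s hs t ht => energy_le_exp_mul_energy hN hl hQ hu hv hq hs ht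
  have hlr : l ≤ π - l := by linarith [pi_gt_three]
  have hsub : Set.Icc l (π - l) ⊆ Set.Ioo 0 π := fun t ht =>
    ⟨by linarith [ht.1], by linarith [ht.2]⟩
  have hvc : ContinuousOn v (Set.Icc l (π - l)) := fun t ht =>
    (hv t (hsub ht)).continuousAt.continuousWithinAt
  have hqc' : ContinuousOn q (Set.Icc l (π - l)) := hqc.mono hsub
  have huc' : ContinuousOn u (Set.Icc l (π - l)) := huc.continuousOn
  have hEi : IntervalIntegrable E volume l (π - l) :=
    ContinuousOn.intervalIntegrable_of_Icc hlr (by fun_prop)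
  have hui : IntervalIntegrable (fun t => (2 * N ^ 2 + 2 * Q / l ^ 2) * u t ^ 2) volume l (π - l) :=
    ContinuousOn.intervalIntegrable_of_Icc hlr (by fun_prop)
  have hdi : IntervalIntegrable (fun t => v t * v t + u t * (-(N ^ 2 + q t) * u t))
      volume l (π - l) := ContinuousOn.intervalIntegrable_of_Icc hlr (by fun_prop)
  have hparts : ∫ t in l..(π - l), (v t * v t + u t * (-(N ^ 2 + q t) * u t)) =
      u (π - l) * v (π - l) - u l * v l := by
    refine intervalIntegral.integral_eq_sub_of_hasDerivAt_of_le hlr (by fun_prop)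
      (fun t ht => (hu t (hsub (Set.Ioo_subset_Icc_self ht))).mul
        (hv t (hsub (Set.Ioo_subset_Icc_self ht)))) hdi
  have hmass : ∫ t in l..(π - l), u t ^ 2 ≤ 1 := by
    refine le_trans ?_ hint
    exact intervalIntegral.integral_mono_interval hl.le hlr (by linarith)
      (Filter.Eventually.of_forall fun t => sq_nonneg _)
      (Continuous.intervalIntegrable (by fun_prop) _ _)
  have hEint : ∫ t in l..(π - l), E t ≤
      (u (π - l) * v (π - l) - u l * v l) + (2 * N ^ 2 + 2 * Q / l ^ 2) := by
    calc ∫ t in l..(π - l), E t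
        ≤ ∫ t in l..(π - l), ((v t * v t + u t * (-(N ^ 2 + q t) * u t)) +
            (2 * N ^ 2 + 2 * Q / l ^ 2) * u t ^ 2) := by
          refine intervalIntegral.integral_mono_on hlr hEi (hdi.add hui) fun t ht => ?_
          have h1 : q t ≤ 2 * Q / l ^ 2 := by
            calc q t ≤ |q t| := le_abs_self _
              _ ≤ Q * (1 / t ^ 2 + 1 / (π - t) ^ 2) := hq t (hsub ht)
              _ ≤ Q * (2 / l ^ 2) := by
                  have := endpoint_weight_le hl ht
                  gcongr
              _ = _ := by ring
          have h2 := mul_le_mul_of_nonneg_right h1 (sq_nonneg (u t))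
          simp only [hE]
          linarith
      _ ≤ _ := by
          rw [intervalIntegral.integral_add hdi hui, hparts, intervalIntegral.integral_const_mul]
          have : (2 * N ^ 2 + 2 * Q / l ^ 2) * ∫ t in l..(π - l), u t ^ 2 ≤
              (2 * N ^ 2 + 2 * Q / l ^ 2) * 1 :=
            mul_le_mul_of_nonneg_left hmass (by positivity)
          linarith
  have hbdry : u (π - l) * v (π - l) - u l * v l ≤ K * E x / N := by
    have b1 := two_mul_abs_mul_le_energy hN (u (π - l)) (v (π - l))
    have b2 := two_mul_abs_mul_le_energy hN (u l) (v l)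
    have b3 : E (π - l) / N ≤ K * E x / N :=
      div_le_div_of_nonneg_right (hcmp _ ⟨hlr, le_rfl⟩ _ hx) hN.le
    have b4 : E l / N ≤ K * E x / N :=
      div_le_div_of_nonneg_right (hcmp _ ⟨le_rfl, hlr⟩ _ hx) hN.le
    have b5 := le_abs_self (u (π - l) * v (π - l))
    have b6 := neg_abs_le (u l * v l)
    simp only [hE] at b3 b4 ⊢
    linarith
  have hlow : (π - 2 * l) * E x ≤ K * ∫ t in l..(π - l), E t := by
    calc (π - 2 * l) * E x = ∫ t in l..(π - l), E x := by
          rw [intervalIntegral.integral_const, smul_eq_mul]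
          ring
      _ ≤ ∫ t in l..(π - l), K * E t :=
          intervalIntegral.integral_mono_on hlr intervalIntegrable_const (hEi.const_mul K)
            fun t ht => hcmp x hx t ht
      _ = _ := intervalIntegral.integral_const_mul _ _
  have h1 : 1 * E x ≤ (π - 2 * l) * E x :=
    mul_le_mul_of_nonneg_right (by linarith [pi_gt_three]) (hE0 x)
  have h2 : K * (K * E x / N) ≤ E x / 2 := by
    rw [show K * (K * E x / N) = K ^ 2 * E x / N by ring, div_le_div_iff₀ hN two_pos]
    nlinarith [hE0 x]
  have h3 : K * ∫ t in l..(π - l), E t ≤ K * (K * E x / N + (2 * N ^ 2 + 2 * Q / l ^ 2)) :=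
    mul_le_mul_of_nonneg_left (by linarith) hK0.le
  change E x ≤ _
  linarith

end Energy

section SupBound

open Polynomial Real MeasureTheory

lemma exists_jacobiPotential_le (a b : ℝ) : ∃ Q : ℝ, 0 ≤ Q ∧ ∀ x ∈ Set.Ioo 0 π,
    |jacobiPotential a b x| ≤ Q * (1 / x ^ 2 + 1 / (π - x) ^ 2) := by
  refine ⟨π ^ 2 / 4 * (|1 / 4 - a ^ 2| + |1 / 4 - b ^ 2|), by positivity, fun x hx => ?_⟩
  have hx0 := hx.1
  have hx1 : 0 < π - x := by linarith [hx.2]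
  have hs : x / π ≤ sin (x / 2) := by
    have := mul_le_sin (x := x / 2) (by linarith) (by linarith [hx.2])
    calc x / π = 2 / π * (x / 2) := by field_simp
      _ ≤ _ := this
  have hc : (π - x) / π ≤ cos (x / 2) := by
    have := mul_le_sin (x := π / 2 - x / 2) (by linarith) (by linarith)
    rw [sin_pi_div_two_sub] at this
    calc (π - x) / π = 2 / π * (π / 2 - x / 2) := by field_simp
      _ ≤ _ := this
  have h1 : 1 / (4 * sin (x / 2) ^ 2) ≤ π ^ 2 / 4 * (1 / x ^ 2) := by
    calc 1 / (4 * sin (x / 2) ^ 2) ≤ 1 / (4 * (x / π) ^ 2) := by gcongr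
      _ = _ := by field_simp
  have h2 : 1 / (4 * cos (x / 2) ^ 2) ≤ π ^ 2 / 4 * (1 / (π - x) ^ 2) := by
    calc 1 / (4 * cos (x / 2) ^ 2) ≤ 1 / (4 * ((π - x) / π) ^ 2) := by gcongr
      _ = _ := by field_simp
  have e1 : 0 ≤ π ^ 2 / 4 * (1 / x ^ 2) := by positivity
  have e2 : 0 ≤ π ^ 2 / 4 * (1 / (π - x) ^ 2) := by positivity
  calc |jacobiPotential a b x| ≤ |1 / 4 - a ^ 2| * (1 / (4 * sin (x / 2) ^ 2)) +
        |1 / 4 - b ^ 2| * (1 / (4 * cos (x / 2) ^ 2)) := by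
        unfold jacobiPotential
        refine (abs_add_le _ _).trans (le_of_eq ?_)
        rw [abs_div, abs_div, abs_of_nonneg (show 0 ≤ 4 * sin (x / 2) ^ 2 by positivity),
          abs_of_nonneg (show 0 ≤ 4 * cos (x / 2) ^ 2 by positivity)]
        ring
    _ ≤ |1 / 4 - a ^ 2| * (π ^ 2 / 4 * (1 / x ^ 2) + π ^ 2 / 4 * (1 / (π - x) ^ 2)) +
        |1 / 4 - b ^ 2| * (π ^ 2 / 4 * (1 / x ^ 2) + π ^ 2 / 4 * (1 / (π - x) ^ 2)) := by
        gcongr <;> linarith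
    _ = _ := by ring

lemma continuousOn_jacobiPotential (a b : ℝ) :
    ContinuousOn (jacobiPotential a b) (Set.Ioo 0 π) := by
  unfold jacobiPotential
  refine ContinuousOn.add (ContinuousOn.div (by fun_prop) (by fun_prop) fun x hx => ?_)
    (ContinuousOn.div (by fun_prop) (by fun_prop) fun x hx => ?_)
  · have := sin_half_pos hx
    positivity
  · have := cos_half_pos hx
    positivity

lemma jacobiEnvelope_le_of_le {a b : ℝ} (ha : -1 / 2 ≤ a) (hb : -1 / 2 ≤ b) {s t : ℝ}
    (hs : 0 ≤ s) (hst : s ≤ t) (ht : t ≤ 1) :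
    jacobiEnvelope a b s ≤ 2 ^ (a + b + 1) * jacobiEnvelope a b t := by
  have hpi := pi_gt_three
  have hs0 : 0 ≤ sin (s / 2) := sin_nonneg_of_nonneg_of_le_pi (by linarith) (by linarith)
  have hsin : sin (s / 2) ≤ sin (t / 2) :=
    sin_le_sin_of_le_of_le_pi_div_two (by linarith) (by linarith) (by linarith)
  have hcs : 0 ≤ cos (s / 2) := cos_nonneg_of_mem_Icc ⟨by linarith, by linarith⟩
  have hct : 1 / 2 ≤ cos (t / 2) := by
    have := one_sub_sq_div_two_le_cos (x := t / 2)
    nlinarith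
  have h1 : sin (s / 2) ^ (a + 1 / 2) ≤ sin (t / 2) ^ (a + 1 / 2) :=
    rpow_le_rpow hs0 hsin (by linarith)
  have h2 : cos (s / 2) ^ (b + 1 / 2) ≤ (2 * cos (t / 2)) ^ (b + 1 / 2) :=
    rpow_le_rpow hcs (by linarith [cos_le_one (s / 2)]) (by linarith)
  rw [mul_rpow (by norm_num) (by linarith)] at h2
  have h3 : (2 : ℝ) ^ (b + 1 / 2) ≤ 2 ^ (a + b + 1) :=
    rpow_le_rpow_of_exponent_le (by norm_num) (by linarith)
  have h4 : 0 ≤ sin (t / 2) ^ (a + 1 / 2) := rpow_nonneg (hs0.trans hsin) _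
  have h5 : 0 ≤ cos (t / 2) ^ (b + 1 / 2) := rpow_nonneg (by linarith) _
  unfold jacobiEnvelope
  calc sin (s / 2) ^ (a + 1 / 2) * cos (s / 2) ^ (b + 1 / 2)
      ≤ sin (t / 2) ^ (a + 1 / 2) * (2 ^ (b + 1 / 2) * cos (t / 2) ^ (b + 1 / 2)) :=
        mul_le_mul h1 h2 (rpow_nonneg hcs _) h4
    _ ≤ sin (t / 2) ^ (a + 1 / 2) * (2 ^ (a + b + 1) * cos (t / 2) ^ (b + 1 / 2)) := by gcongr
    _ = _ := by ring

/-- Near the end point `0`, a solution that is regular there is controlled by its value at distance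
of order `lam ^ (-1/2)`. -/
lemma abs_jacobiMode_le_near_zero {a b lam l : ℝ} (ha : -1 / 2 ≤ a) (hb : -1 / 2 ≤ b)
    {P : ℝ[X]} (h : SolvesJacobiODE a b lam P) (hlam : 0 ≤ lam) (hl : 0 < l) (hl1 : l ≤ 1)
    (hsmall : lam * ((2 : ℝ) ^ (a + b + 1)) ^ 2 * l ^ 2 ≤ 1 / 2) {x : ℝ} (hx0 : 0 < x)
    (hxl : x ≤ l) :
    |jacobiMode a b P x| ≤ 2 * (2 : ℝ) ^ (a + b + 1) * |jacobiMode a b P l| := by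
  set D : ℝ := 2 ^ (a + b + 1) with hD
  have hD0 : 0 < D := by positivity
  have hpi := pi_gt_three
  set y : ℝ → ℝ := fun t => P.eval (cos t) with hy
  have hyc : Continuous y := P.continuous.comp continuous_cos
  obtain ⟨x₀, hx₀, hmax⟩ := isCompact_Icc.exists_isMaxOn (Set.nonempty_Icc.mpr hl.le)
    (hyc.abs.continuousOn (s := Set.Icc 0 l))
  set M := |y x₀| with hM
  have hyM : ∀ t ∈ Set.Icc 0 l, |y t| ≤ M := fun t ht => hmax ht
  have hmem : ∀ t, 0 < t → t ≤ l → t ∈ Set.Ioo 0 π := fun t h0 h1 => ⟨h0, by linarith⟩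
  have hder : ∀ t ∈ Set.Ioo 0 l, |sin t * (derivative P).eval (cos t)| ≤ lam * D ^ 2 * M * l := by
    intro t ht
    have htp := hmem t ht.1 ht.2.le
    have henv := jacobiEnvelope_pos a b htp
    have hc3 := continuous_jacobiEnvelope ha hb
    obtain ⟨s, hs, hslope⟩ := exists_hasDerivAt_eq_slope
      (fun t => jacobiEnvelope a b t ^ 2 * (sin t * (derivative P).eval (cos t)))
      (fun t => lam * jacobiEnvelope a b t ^ 2 * P.eval (cos t)) ht.1
      (by fun_prop) (fun s hs => hasDerivAt_envelope_sq_mul h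
        (hmem s hs.1 (hs.2.le.trans ht.2.le)))
    simp only [sin_zero, zero_mul, mul_zero, sub_zero] at hslope
    rw [eq_div_iff ht.1.ne'] at hslope
    have hes := jacobiEnvelope_le_of_le ha hb hs.1.le hs.2.le (ht.2.le.trans hl1)
    have hes0 := jacobiEnvelope_pos a b (hmem s hs.1 (hs.2.le.trans ht.2.le))
    have hyM' := hyM s ⟨hs.1.le, hs.2.le.trans ht.2.le⟩
    have hM0 : 0 ≤ M := abs_nonneg _
    have key : jacobiEnvelope a b t ^ 2 * |sin t * (derivative P).eval (cos t)| ≤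
        jacobiEnvelope a b t ^ 2 * (lam * D ^ 2 * M * l) := by
      calc jacobiEnvelope a b t ^ 2 * |sin t * (derivative P).eval (cos t)|
          = |jacobiEnvelope a b t ^ 2 * (sin t * (derivative P).eval (cos t))| := by
            rw [abs_mul (_ ^ 2), abs_of_nonneg (sq_nonneg (jacobiEnvelope a b t))]
        _ = lam * jacobiEnvelope a b s ^ 2 * |y s| * t := by
            rw [← hslope, abs_mul, abs_mul, abs_of_pos ht.1,
              abs_of_nonneg (mul_nonneg hlam (sq_nonneg (jacobiEnvelope a b s)))]
        _ ≤ lam * (D * jacobiEnvelope a b t) ^ 2 * M * l := by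
            have := ht.2.le
            have := ht.1.le
            gcongr
        _ = _ := by ring
    exact le_of_mul_le_mul_left key (by positivity)
  have hlip : |y x₀ - y l| ≤ M / 2 := by
    rcases eq_or_lt_of_le hx₀.2 with he | hlt
    · rw [he]
      simp only [sub_self, abs_zero]
      positivity
    obtain ⟨s, hs, hslope⟩ := exists_hasDerivAt_eq_slope y _ hlt hyc.continuousOn
      (fun s _ => hasDerivAt_eval_cos P s)
    rw [eq_div_iff (by linarith)] at hslope
    have h1 := hder s ⟨hx₀.1.trans_lt hs.1, hs.2⟩
    have hM0 : 0 ≤ M := abs_nonneg _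
    rw [abs_sub_comm, ← hslope, abs_mul, abs_neg, abs_of_pos (by linarith : 0 < l - x₀)]
    calc |sin s * (derivative P).eval (cos s)| * (l - x₀) ≤ (lam * D ^ 2 * M * l) * l :=
          mul_le_mul h1 (by linarith [hx₀.1]) (by linarith) (by positivity)
      _ = (lam * D ^ 2 * l ^ 2) * M := by ring
      _ ≤ 1 / 2 * M := mul_le_mul_of_nonneg_right hsmall hM0
      _ = M / 2 := by ring
  have hM2 : M ≤ 2 * |y l| := by
    have := abs_sub_abs_le_abs_sub (y x₀) (y l)
    linarith
  have hex := jacobiEnvelope_le_of_le ha hb hx0.le hxl hl1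
  have hex0 := jacobiEnvelope_pos a b (hmem x hx0 hxl)
  have hel0 := jacobiEnvelope_pos a b (hmem l hl le_rfl)
  unfold jacobiMode
  rw [abs_mul, abs_mul, abs_of_pos hex0, abs_of_pos hel0]
  calc jacobiEnvelope a b x * |y x| ≤ (D * jacobiEnvelope a b l) * (2 * |y l|) :=
        mul_le_mul hex ((hyM x ⟨hx0.le, hxl⟩).trans hM2) (abs_nonneg _) (by positivity)
    _ = _ := by ring

/-- Uniform bound for normalized solutions of the Jacobi equation of large degree. -/
lemma exists_abs_jacobiMode_le_of_large {a b : ℝ} (ha : -1 / 2 ≤ a) (hb : -1 / 2 ≤ b) :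
    ∃ B N₀ : ℝ, ∀ (lam N : ℝ) (P : ℝ[X]), SolvesJacobiODE a b lam P → 0 ≤ lam →
      lam + ((a + b + 1) / 2) ^ 2 = N ^ 2 → N₀ ≤ N →
      ∫ x in (0 : ℝ)..π, jacobiMode a b P x ^ 2 ≤ 1 →
      ∀ x ∈ Set.Ioo 0 π, |jacobiMode a b P x| ≤ B := by
  obtain ⟨Q, hQ, hpot⟩ := exists_jacobiPotential_le a b
  set D : ℝ := 2 ^ (a + b + 1) with hD
  have hD1 : 1 ≤ D := one_le_rpow (by norm_num) (by linarith)
  set c : ℝ := 1 / (2 * D) with hc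
  have hc0 : 0 < c := by positivity
  have hc1 : c ≤ 1 := by
    rw [hc, div_le_one (by positivity)]
    linarith
  set K := exp (2 * Q / c) with hK
  have hK0 : 0 < K := exp_pos _
  set B₁ := 2 * K * (2 + 2 * Q / c ^ 2) with hB₁
  have hB₁0 : 0 ≤ B₁ := by positivity
  refine ⟨2 * D * (1 + B₁), max 1 (2 * K ^ 2), fun lam N P hP hlam hN hN₀ hint => ?_⟩
  have hN1 : 1 ≤ N := (le_max_left _ _).trans hN₀
  have hNK : 2 * K ^ 2 ≤ N := (le_max_right _ _).trans hN₀
  have hN0 : 0 < N := by linarith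
  set l := c / N with hl
  have hl0 : 0 < l := by positivity
  have hl1 : l ≤ 1 := by
    rw [hl, div_le_one hN0]
    linarith
  have hNl : N * l = c := by rw [hl]; field_simp
  have hmid : ∀ x ∈ Set.Icc l (π - l), |jacobiMode a b P x| ≤ 1 + B₁ := by
    intro x hx
    have hE := energy_le_of_integral_sq_le_one (u := jacobiMode a b P)
      (v := jacobiModeDeriv a b P) (q := jacobiPotential a b) hN0 hl0 hl1 hQ
      (fun x hx => hasDerivAt_jacobiMode a b P hx)
      (fun x hx => by rw [← hN]; exact hasDerivAt_jacobiModeDeriv hP hx) hpot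
      (continuousOn_jacobiPotential a b) (continuous_jacobiMode ha hb P) hint
      (by rw [hNl]; exact hNK) hx
    rw [hNl, ← hK] at hE
    have e : 2 * Q / l ^ 2 = N ^ 2 * (2 * Q / c ^ 2) := by
      rw [hl]
      field_simp
    rw [e] at hE
    have hsq : N ^ 2 * jacobiMode a b P x ^ 2 ≤ N ^ 2 * B₁ := by
      rw [hB₁]
      nlinarith [sq_nonneg (jacobiModeDeriv a b P x)]
    have hsq' : jacobiMode a b P x ^ 2 ≤ B₁ := le_of_mul_le_mul_left hsq (by positivity)
    apply abs_le_of_sq_le_sq _ (by linarith)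
    nlinarith
  have hsmall : lam * D ^ 2 * l ^ 2 ≤ 1 / 2 := by
    have h1 : lam ≤ N ^ 2 := by
      rw [← hN]
      linarith [sq_nonneg ((a + b + 1) / 2)]
    calc lam * D ^ 2 * l ^ 2 ≤ N ^ 2 * D ^ 2 * l ^ 2 := by gcongr
      _ = (N * l) ^ 2 * D ^ 2 := by ring
      _ = 1 / 4 := by
          rw [hNl, hc]
          field_simp
          norm_num
      _ ≤ 1 / 2 := by norm_num
  have hlmem : l ∈ Set.Icc l (π - l) := ⟨le_rfl, by linarith [pi_gt_three]⟩
  have hrmem : π - l ∈ Set.Icc l (π - l) := ⟨by linarith [pi_gt_three], le_rfl⟩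
  intro x hx
  rcases le_or_gt x l with h1 | h1
  · calc |jacobiMode a b P x| ≤ 2 * D * |jacobiMode a b P l| :=
          abs_jacobiMode_le_near_zero ha hb hP hlam hl0 hl1 hsmall hx.1 h1
      _ ≤ 2 * D * (1 + B₁) := by
          have := hmid l hlmem
          gcongr
  rcases le_or_gt x (π - l) with h2 | h2
  · calc |jacobiMode a b P x| ≤ 1 * (1 + B₁) := by
          rw [one_mul]
          exact hmid x ⟨h1.le, h2⟩
      _ ≤ 2 * D * (1 + B₁) := by
          gcongr
          linarith
  · have hba : (2 : ℝ) ^ (b + a + 1) = D := by rw [hD, add_comm b a]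
    have h3 := abs_jacobiMode_le_near_zero (x := π - x) hb ha hP.comp_neg_X hlam hl0 hl1
      (by rw [hba]; exact hsmall) (by linarith [hx.2]) (by linarith)
    have h4 := jacobiMode_reflect a b P (π - l)
    rw [jacobiMode_reflect, hba] at h3
    rw [sub_sub_cancel] at h4
    rw [h4] at h3
    calc _ ≤ _ := h3
      _ ≤ 2 * D * (1 + B₁) := by
          have := hmid (π - l) hrmem
          gcongr

lemma normalizedJacobiPoly_solves (n : ℕ) (a b : ℝ) :
    SolvesJacobiODE a b (n * (n + a + b + 1)) (normalizedJacobiPoly n a b) :=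
  (jacobiPoly_solves n a b).const_mul _

/-- The orthonormal Jacobi functions with parameters at least `-1/2` are uniformly bounded. -/
theorem exists_abs_jacobiMode_normalizedJacobiPoly_le {a b : ℝ} (ha : -1 / 2 ≤ a)
    (hb : -1 / 2 ≤ b) : ∃ B : ℝ, 0 < B ∧ ∀ (n : ℕ), ∀ x ∈ Set.Icc 0 π,
      |jacobiMode a b (normalizedJacobiPoly n a b) x| ≤ B := by
  obtain ⟨B, N₀, hB⟩ := exists_abs_jacobiMode_le_of_large ha hb
  have hex : ∀ n : ℕ, ∃ C : ℝ, ∀ x ∈ Set.Icc 0 π,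
      ‖jacobiMode a b (normalizedJacobiPoly n a b) x‖ ≤ C := fun n =>
    isCompact_Icc.exists_bound_of_continuousOn (continuous_jacobiMode ha hb _).continuousOn
  choose C hC using hex
  obtain ⟨k, hk⟩ := exists_nat_ge N₀
  refine ⟨1 + |B| + ∑ i ∈ Finset.range (k + 1), |C i|, by positivity, fun n => ?_⟩
  have hclosed := isClosed_le (continuous_jacobiMode ha hb (normalizedJacobiPoly n a b)).abs
    (continuous_const (y := 1 + |B| + ∑ i ∈ Finset.range (k + 1), |C i|))
  rw [← closure_Ioo pi_pos.ne]
  refine closure_minimal (fun x hx => ?_) hclosed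
  change |jacobiMode a b (normalizedJacobiPoly n a b) x| ≤ _
  have hs : 0 ≤ ∑ i ∈ Finset.range (k + 1), |C i| := by positivity
  rcases lt_or_ge n (k + 1) with h | h
  · have h1 := hC n x (Set.Ioo_subset_Icc_self hx)
    have h2 := Finset.single_le_sum (f := fun i => |C i|) (fun i _ => abs_nonneg _)
      (Finset.mem_range.mpr h)
    have h3 := le_abs_self (C n)
    have h4 := abs_nonneg B
    rw [norm_eq_abs] at h1
    linarith
  · have hn : (k : ℝ) + 1 ≤ n := by exact_mod_cast h
    have hk0 : (0 : ℝ) ≤ k := k.cast_nonneg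
    have h1 := hB (n * (n + a + b + 1)) (n + (a + b + 1) / 2) _ (normalizedJacobiPoly_solves n a b)
      (mul_nonneg (by linarith) (by linarith)) (by ring) (by linarith)
      (integral_normalizedJacobiPoly_sq ha hb (by omega)).le x hx
    have h3 := le_abs_self B
    linarith

end SupBound

section Kernel

open Polynomial Real MeasureTheory

/-- Landau's inequality on an interval of length `h`. -/
lemma abs_deriv_le_of_abs_le {f f' f'' : ℝ → ℝ} {p h A D : ℝ} (hh : 0 < h)
    (hf : ∀ x ∈ Set.Icc p (p + h), HasDerivAt f (f' x) x)
    (hf' : ∀ x ∈ Set.Icc p (p + h), HasDerivAt f' (f'' x) x)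
    (hA : ∀ x ∈ Set.Icc p (p + h), |f x| ≤ A) (hD : ∀ x ∈ Set.Icc p (p + h), |f'' x| ≤ D)
    {x : ℝ} (hx : x ∈ Set.Icc p (p + h)) : |f' x| ≤ 2 * A / h + D * h := by
  obtain ⟨y, hy, hslope⟩ := exists_hasDerivAt_eq_slope f f' (by linarith : p < p + h)
    (fun x hx => (hf x hx).continuousAt.continuousWithinAt)
    (fun x hx => hf x (Set.Ioo_subset_Icc_self hx))
  have hy' := Set.Ioo_subset_Icc_self hy
  have h1 : |f' y| ≤ 2 * A / h := by
    rw [hslope, add_sub_cancel_left, abs_div, abs_of_pos hh]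
    have e1 := hA p ⟨le_rfl, by linarith⟩
    have e2 := hA (p + h) ⟨by linarith, le_rfl⟩
    have e3 := abs_sub (f (p + h)) (f p)
    gcongr
    linarith
  have h2 : |f' x - f' y| ≤ D * |x - y| :=
    (convex_Icc p (p + h)).norm_image_sub_le_of_norm_hasDerivWithin_le
      (fun t ht => (hf' t ht).hasDerivWithinAt) hD hy' hx
  have hD0 : 0 ≤ D := (abs_nonneg _).trans (hD x hx)
  have h3 : |x - y| ≤ h := abs_le.mpr ⟨by linarith [hx.1, hy'.2], by linarith [hx.2, hy'.1]⟩
  have h4 : D * |x - y| ≤ D * h := mul_le_mul_of_nonneg_left h3 hD0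
  have h5 := abs_sub_abs_le_abs_sub (f' x) (f' y)
  linarith

lemma exists_abs_jacobiModeDeriv_le {a b : ℝ} (ha : -1 / 2 ≤ a) (hb : -1 / 2 ≤ b) :
    ∃ A : ℝ, 0 < A ∧ ∀ k n : ℕ, k ≤ n → 2 ≤ n →
      |jacobiModeDeriv a b (normalizedJacobiPoly k a b) (1 / n)| ≤ A * n ∧
      |jacobiModeDeriv a b (normalizedJacobiPoly k a b) (π - 1 / n)| ≤ A * n := by
  obtain ⟨B, hB0, hB⟩ := exists_abs_jacobiMode_normalizedJacobiPoly_le ha hb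
  obtain ⟨Q, hQ, hpot⟩ := exists_jacobiPotential_le a b
  set s := (a + b + 1) / 2 with hs
  have hs0 : 0 ≤ s := by rw [hs]; linarith
  refine ⟨2 * B + ((1 + s) ^ 2 + 2 * Q) * B, by positivity, fun k n hkn hn => ?_⟩
  have hn2 : (2 : ℝ) ≤ n := by exact_mod_cast hn
  have hn0 : (0 : ℝ) < n := by linarith
  have hkn' : (k : ℝ) ≤ n := by exact_mod_cast hkn
  have hk0 : (0 : ℝ) ≤ k := k.cast_nonneg
  set e : ℝ := 1 / n with he
  have he0 : 0 < e := by positivity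
  have he1 : e ≤ 1 / 2 := by rw [he]; gcongr
  have hpi := pi_gt_three
  have hmem : ∀ x ∈ Set.Icc e (π - e), x ∈ Set.Ioo 0 π := fun x hx =>
    ⟨by linarith [hx.1], by linarith [hx.2]⟩
  set P := normalizedJacobiPoly k a b with hP
  have hsecond : ∀ x ∈ Set.Icc e (π - e),
      |-(k * (k + a + b + 1) + s ^ 2 + jacobiPotential a b x) * jacobiMode a b P x| ≤
        ((1 + s) ^ 2 + 2 * Q) * n ^ 2 * B := by
    intro x hx
    have h1 : |jacobiPotential a b x| ≤ 2 * Q * n ^ 2 := by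
      calc _ ≤ Q * (1 / x ^ 2 + 1 / (π - x) ^ 2) := hpot x (hmem x hx)
        _ ≤ Q * (2 / e ^ 2) := by
            have := endpoint_weight_le he0 hx
            gcongr
        _ = _ := by
            rw [he]
            field_simp
    have h2 : |(k : ℝ) * (k + a + b + 1) + s ^ 2| ≤ (1 + s) ^ 2 * n ^ 2 := by
      rw [show (k : ℝ) * (k + a + b + 1) + s ^ 2 = (k + s) ^ 2 by rw [hs]; ring,
        abs_of_nonneg (sq_nonneg _), ← mul_pow]
      gcongr
      nlinarith
    rw [abs_mul, abs_neg]
    refine mul_le_mul ((abs_add_le _ _).trans ?_) (hB k x (Set.Ioo_subset_Icc_self (hmem x hx)))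
      (abs_nonneg _) (by positivity)
    linarith
  have hlandau : ∀ p : ℝ, e ≤ p → p + e ≤ π - e → ∀ x ∈ Set.Icc p (p + e),
      |jacobiModeDeriv a b P x| ≤ (2 * B + ((1 + s) ^ 2 + 2 * Q) * B) * n := by
    intro p hp1 hp2 x hx
    have hsub : ∀ t ∈ Set.Icc p (p + e), t ∈ Set.Icc e (π - e) := fun t ht =>
      ⟨hp1.trans ht.1, ht.2.trans hp2⟩
    have := abs_deriv_le_of_abs_le he0
      (fun t ht => hasDerivAt_jacobiMode a b P (hmem t (hsub t ht)))
      (fun t ht => hasDerivAt_jacobiModeDeriv (normalizedJacobiPoly_solves k a b)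
        (hmem t (hsub t ht)))
      (fun t ht => hB k t (Set.Ioo_subset_Icc_self (hmem t (hsub t ht))))
      (fun t ht => hsecond t (hsub t ht)) hx
    refine this.trans (le_of_eq ?_)
    rw [he]
    field_simp
  exact ⟨hlandau e le_rfl (by linarith) e ⟨le_rfl, by linarith⟩,
    hlandau (π - e - e) (by linarith) (by linarith) (π - e) ⟨by linarith, by linarith⟩⟩

lemma exists_abs_integral_jacobiMode_mul_le {a b c d : ℝ} (ha : -1 / 2 ≤ a) (hb : -1 / 2 ≤ b)
    (hc : -1 / 2 ≤ c) (hd : -1 / 2 ≤ d) :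
    ∃ C : ℝ, 0 < C ∧ ∀ n m : ℕ, m < n →
      |∫ x in (0 : ℝ)..π, jacobiMode c d (normalizedJacobiPoly n c d) x *
        jacobiMode a b (normalizedJacobiPoly m a b) x| ≤ C / ((n : ℝ) - m) := by
  obtain ⟨B₁, hB₁0, hB₁⟩ := exists_abs_jacobiMode_normalizedJacobiPoly_le hc hd
  obtain ⟨B₂, hB₂0, hB₂⟩ := exists_abs_jacobiMode_normalizedJacobiPoly_le ha hb
  obtain ⟨Q₁, hQ₁0, hQ₁⟩ := exists_jacobiPotential_le c d
  obtain ⟨Q₂, hQ₂0, hQ₂⟩ := exists_jacobiPotential_le a b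
  obtain ⟨A₁, hA₁0, hA₁⟩ := exists_abs_jacobiModeDeriv_le hc hd
  obtain ⟨A₂, hA₂0, hA₂⟩ := exists_abs_jacobiModeDeriv_le ha hb
  set s := (c + d - a - b) / 2 with hs
  set T := 2 * (B₁ * A₂ + A₁ * B₂) + 2 * (Q₁ + Q₂) * (B₁ * B₂) with hT
  have hT0 : 0 < T := by positivity
  refine ⟨π * (B₁ * B₂) * (2 * |s| + 2) + (2 * T + 2 * (B₁ * B₂)), by positivity,
    fun n m hmn => ?_⟩
  have hmn' : (m : ℝ) < n := by exact_mod_cast hmn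
  have hpos : (0 : ℝ) < n - m := by linarith
  have hm0 : (0 : ℝ) ≤ m := m.cast_nonneg
  have hn0 : (0 : ℝ) < n := by linarith
  have hpi := pi_gt_three
  set U := jacobiMode c d (normalizedJacobiPoly n c d) with hU
  set V := jacobiMode a b (normalizedJacobiPoly m a b) with hV
  set U' := jacobiModeDeriv c d (normalizedJacobiPoly n c d) with hU'
  set V' := jacobiModeDeriv a b (normalizedJacobiPoly m a b) with hV'
  have hUc : Continuous U := continuous_jacobiMode hc hd _
  have hVc : Continuous V := continuous_jacobiMode ha hb _
  have hUV : ∀ x ∈ Set.Icc 0 π, |U x * V x| ≤ B₁ * B₂ := fun x hx => by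
    rw [abs_mul]
    exact mul_le_mul (hB₁ n x hx) (hB₂ m x hx) (abs_nonneg _) hB₁0.le
  have hpiece : ∀ r t : ℝ, 0 ≤ r → r ≤ t → t ≤ π →
      |∫ x in r..t, U x * V x| ≤ B₁ * B₂ * (t - r) := by
    intro r t h0 h1 h2
    have := intervalIntegral.norm_integral_le_of_norm_le_const (a := r) (b := t)
      (f := fun x => U x * V x) (C := B₁ * B₂) (fun x hx => by
        rw [Set.uIoc_of_le h1] at hx
        exact hUV x ⟨by linarith [hx.1], by linarith [hx.2]⟩)
    rwa [abs_of_nonneg (by linarith : 0 ≤ t - r)] at this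
  rw [le_div_iff₀ hpos]
  rcases lt_or_ge ((n : ℝ) - m) (2 * |s| + 2) with hnear | hfar
  · have h1 := hpiece 0 π le_rfl pi_pos.le le_rfl
    calc _ ≤ (B₁ * B₂ * (π - 0)) * (2 * |s| + 2) :=
          mul_le_mul h1 hnear.le hpos.le (by rw [sub_zero]; positivity)
      _ = π * (B₁ * B₂) * (2 * |s| + 2) := by ring
      _ ≤ _ := by
          have : 0 < 2 * T + 2 * (B₁ * B₂) := by positivity
          linarith
  have hn2 : 2 ≤ n := by
    have : (2 : ℝ) ≤ n := by linarith [abs_nonneg s]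
    exact_mod_cast this
  have hn2' : (2 : ℝ) ≤ n := by exact_mod_cast hn2
  set e : ℝ := 1 / n with he
  have he0 : 0 < e := by positivity
  have he1 : e ≤ 1 / 2 := by rw [he]; gcongr
  have hle : e ≤ π - e := by linarith
  have hmem : ∀ x ∈ Set.Icc e (π - e), x ∈ Set.Ioo 0 π := fun x hx =>
    ⟨by linarith [hx.1], by linarith [hx.2]⟩
  have hsplit : ∫ x in (0 : ℝ)..π, U x * V x = (∫ x in (0 : ℝ)..e, U x * V x) +
      (∫ x in e..(π - e), U x * V x) + ∫ x in (π - e)..π, U x * V x := by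
    have hi : ∀ r t : ℝ, IntervalIntegrable (fun x => U x * V x) volume r t := fun r t =>
      (hUc.mul hVc).intervalIntegrable r t
    rw [intervalIntegral.integral_add_adjacent_intervals (hi _ _) (hi _ _),
      intervalIntegral.integral_add_adjacent_intervals (hi _ _) (hi _ _)]
  set L : ℝ := ((n : ℝ) * (n + c + d + 1) + ((c + d + 1) / 2) ^ 2) -
    ((m : ℝ) * (m + a + b + 1) + ((a + b + 1) / 2) ^ 2) with hL
  set p : ℝ → ℝ := fun x => jacobiPotential c d x - jacobiPotential a b x with hp
  have hpc : ContinuousOn p (Set.Icc e (π - e)) :=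
    ((continuousOn_jacobiPotential c d).sub (continuousOn_jacobiPotential a b)).mono hmem
  have hF : ∀ x ∈ Set.Icc e (π - e), HasDerivAt (fun t => U t * V' t - U' t * V t)
      (L * (U x * V x) + p x * (U x * V x)) x := by
    intro x hx
    have hx' := hmem x hx
    refine (((hasDerivAt_jacobiMode c d _ hx').mul (hasDerivAt_jacobiModeDeriv
      (normalizedJacobiPoly_solves m a b) hx')).sub ((hasDerivAt_jacobiModeDeriv
      (normalizedJacobiPoly_solves n c d) hx').mul
      (hasDerivAt_jacobiMode a b _ hx'))).congr_deriv ?_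
    simp only [hL, hp]
    ring
  have i1 : IntervalIntegrable (fun x => L * (U x * V x)) volume e (π - e) :=
    Continuous.intervalIntegrable (by fun_prop) _ _
  have i2 : IntervalIntegrable (fun x => p x * (U x * V x)) volume e (π - e) :=
    ContinuousOn.intervalIntegrable_of_Icc hle (hpc.mul (hUc.mul hVc).continuousOn)
  have hftc := intervalIntegral.integral_eq_sub_of_hasDerivAt
    (fun x hx => hF x (by rwa [Set.uIcc_of_le hle] at hx)) (i1.add i2)
  rw [intervalIntegral.integral_add i1 i2, intervalIntegral.integral_const_mul] at hftc
  have hgi : IntervalIntegrable (fun x => (1 / x ^ 2 + 1 / (π - x) ^ 2)) volume e (π - e) := by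
    refine ContinuousOn.intervalIntegrable_of_Icc hle (ContinuousOn.add
      (ContinuousOn.div (by fun_prop) (by fun_prop) fun x hx => ?_)
      (ContinuousOn.div (by fun_prop) (by fun_prop) fun x hx => ?_))
    · have := (hmem x hx).1
      positivity
    · have : 0 < π - x := by linarith [(hmem x hx).2]
      positivity
  have hpot : |∫ x in e..(π - e), p x * (U x * V x)| ≤ 2 * (Q₁ + Q₂) * (B₁ * B₂) * n := by
    calc |∫ x in e..(π - e), p x * (U x * V x)|
        ≤ ∫ x in e..(π - e), (Q₁ + Q₂) * (B₁ * B₂) * (1 / x ^ 2 + 1 / (π - x) ^ 2) := by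
          rw [← norm_eq_abs]
          refine intervalIntegral.norm_integral_le_of_norm_le hle
            (Filter.Eventually.of_forall fun x hx => ?_) (hgi.const_mul _)
          have hx' := hmem x (Set.Ioc_subset_Icc_self hx)
          have h1 : |p x| ≤ (Q₁ + Q₂) * (1 / x ^ 2 + 1 / (π - x) ^ 2) := by
            have e1 := abs_sub (jacobiPotential c d x) (jacobiPotential a b x)
            have e2 := hQ₁ x hx'
            have e3 := hQ₂ x hx'
            simp only [hp]
            linarith
          rw [norm_mul]
          calc _ ≤ (Q₁ + Q₂) * (1 / x ^ 2 + 1 / (π - x) ^ 2) * (B₁ * B₂) :=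
                mul_le_mul h1 (hUV x (Set.Ioo_subset_Icc_self hx')) (abs_nonneg _)
                  (by positivity)
            _ = _ := by ring
      _ = (Q₁ + Q₂) * (B₁ * B₂) * ((1 / (π - (π - e)) - 1 / (π - e)) -
            (1 / (π - e) - 1 / e)) := by
          rw [intervalIntegral.integral_const_mul, intervalIntegral.integral_eq_sub_of_hasDerivAt
            (fun x hx => hasDerivAt_endpoint_primitive
              (hmem x (by rwa [Set.uIcc_of_le hle] at hx))) hgi]
      _ ≤ (Q₁ + Q₂) * (B₁ * B₂) * (2 / e) := by
          have := endpoint_primitive_sub_le he0 (x := e) (y := π - e) ⟨le_rfl, hle⟩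
            ⟨hle, le_rfl⟩
          gcongr
      _ = _ := by
          rw [he]
          field_simp
  have hW : ∀ x ∈ Set.Icc 0 π, |U' x| ≤ A₁ * n → |V' x| ≤ A₂ * n →
      |U x * V' x - U' x * V x| ≤ (B₁ * A₂ + A₁ * B₂) * n := by
    intro x hx h1 h2
    calc |U x * V' x - U' x * V x| ≤ |U x| * |V' x| + |U' x| * |V x| := by
          rw [← abs_mul, ← abs_mul]
          exact abs_sub _ _
      _ ≤ B₁ * (A₂ * n) + (A₁ * n) * B₂ :=
          add_le_add (mul_le_mul (hB₁ n x hx) h2 (abs_nonneg _) hB₁0.le)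
            (mul_le_mul h1 (hB₂ m x hx) (abs_nonneg _) (by positivity))
      _ = _ := by ring
  have hWl := hW e ⟨he0.le, by linarith⟩ (hA₁ n n le_rfl hn2).1 (hA₂ m n hmn.le hn2).1
  have hWr := hW (π - e) ⟨by linarith, by linarith⟩ (hA₁ n n le_rfl hn2).2
    (hA₂ m n hmn.le hn2).2
  set I := ∫ x in e..(π - e), U x * V x with hI
  have hLI : |L * I| ≤ T * n := by
    have e1 : L * I = (U (π - e) * V' (π - e) - U' (π - e) * V (π - e)) -
        (U e * V' e - U' e * V e) - ∫ x in e..(π - e), p x * (U x * V x) := by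
      linarith
    rw [e1, hT]
    refine (abs_sub _ _).trans ?_
    have := abs_sub (U (π - e) * V' (π - e) - U' (π - e) * V (π - e)) (U e * V' e - U' e * V e)
    linarith
  have hLlow : n * (((n : ℝ) - m) / 2) ≤ L := by
    have hL' : L = ((n + (c + d + 1) / 2) + (m + (a + b + 1) / 2)) * (n - m + s) := by
      rw [hL, hs]
      ring
    rw [hL']
    have := neg_abs_le s
    exact mul_le_mul (by linarith) (by linarith) (by linarith) (by linarith)
  have hmid : |I| * (n - m) ≤ 2 * T := by
    have h1 : |I| * (n * (((n : ℝ) - m) / 2)) ≤ T * n := by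
      calc _ ≤ |I| * L := mul_le_mul_of_nonneg_left hLlow (abs_nonneg _)
        _ = |L * I| := by
            rw [abs_mul, abs_of_nonneg (le_trans (by positivity) hLlow), mul_comm]
        _ ≤ _ := hLI
    refine le_of_mul_le_mul_right ?_ hn0
    linarith
  have hend : e * (n - m) ≤ 1 := by
    rw [he, one_div, inv_mul_le_iff₀ hn0]
    linarith
  have h1 := hpiece 0 e le_rfl he0.le (by linarith)
  have h3 := hpiece (π - e) π (by linarith) (by linarith) le_rfl
  have htot : |∫ x in (0 : ℝ)..π, U x * V x| ≤ |I| + 2 * (B₁ * B₂) * e := by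
    rw [hsplit]
    refine (abs_add_le _ _).trans ?_
    have := abs_add_le (∫ x in (0 : ℝ)..e, U x * V x) I
    linarith
  calc _ ≤ (|I| + 2 * (B₁ * B₂) * e) * (n - m) := mul_le_mul_of_nonneg_right htot hpos.le
    _ = |I| * (n - m) + 2 * (B₁ * B₂) * (e * (n - m)) := by ring
    _ ≤ 2 * T + 2 * (B₁ * B₂) * 1 := by gcongr
    _ ≤ _ := by
        have : 0 ≤ π * (B₁ * B₂) * (2 * |s| + 2) := by positivity
        linarith

end Kernel

theorem mainTheorem4 (α β γ δ : ℝ)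
    (hα : -1 / 2 ≤ α) (hβ : -1 / 2 ≤ β) (hγ : -1 / 2 ≤ γ) (hδ : -1 / 2 ≤ δ)
    (hαγ : α ≠ γ) (hβδ : β ≠ δ) :
    (∀ n m : ℕ, IntervalIntegrable
      (fun x => jacobiFun γ δ n x * jacobiFun α β m x) MeasureTheory.volume 0 Real.pi) ∧
    ∃ C : ℝ, 0 < C ∧ ∀ n m : ℕ, n ≠ m →
      |transplantationKernel α β γ δ n m| ≤ C / |(n : ℝ) - (m : ℝ)| := by
  have hcongr : ∀ n m : ℕ, Set.EqOn (fun x => jacobiFun γ δ n x * jacobiFun α β m x)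
      (fun x => jacobiMode γ δ (normalizedJacobiPoly n γ δ) x *
        jacobiMode α β (normalizedJacobiPoly m α β) x) (Set.Ioo 0 Real.pi) := by
    intro n m x hx
    simp only [jacobiFun_eq_jacobiMode _ _ _ hx]
  refine ⟨fun n m => ?_, ?_⟩
  · rw [intervalIntegrable_iff_integrableOn_Ioo_of_le Real.pi_pos.le,
      MeasureTheory.integrableOn_congr_fun (hcongr n m) measurableSet_Ioo,
      ← intervalIntegrable_iff_integrableOn_Ioo_of_le Real.pi_pos.le]
    exact ((continuous_jacobiMode hγ hδ _).mul
      (continuous_jacobiMode hα hβ _)).intervalIntegrable _ _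
  · obtain ⟨C₁, hC₁0, hC₁⟩ := exists_abs_integral_jacobiMode_mul_le hα hβ hγ hδ
    obtain ⟨C₂, hC₂0, hC₂⟩ := exists_abs_integral_jacobiMode_mul_le hγ hδ hα hβ
    refine ⟨C₁ + C₂, by positivity, fun n m hnm => ?_⟩
    rw [transplantationKernel,
      intervalIntegral.integral_congr_Ioo_of_le Real.pi_pos.le (hcongr n m)]
    rcases lt_or_gt_of_ne hnm with h | h
    · have h' : (n : ℝ) < m := by exact_mod_cast h
      have h1 := hC₂ m n h
      simp_rw [mul_comm (jacobiMode α β _ _)] at h1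
      rw [abs_sub_comm, abs_of_pos (by linarith : (0 : ℝ) < m - n)]
      refine h1.trans (div_le_div_of_nonneg_right (by linarith) (by linarith))
    · have h' : (m : ℝ) < n := by exact_mod_cast h
      rw [abs_of_pos (by linarith : (0 : ℝ) < n - m)]
      exact (hC₁ n m h).trans (div_le_div_of_nonneg_right (by linarith) (by linarith))
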